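/- Let $\epsilon=t\,\frac{d}{dt}$. A Fuchsian operator of order $n\ge 0$ is a differential operator $L=\sum_{i=0}^n a_i(t)\epsilon^{i}$ whose coefficients $a_i$ are germs of holomorphic functions at $0\in\mathbb C$ and $a_n(0)\neq 0$. Expanding the coefficients in powers of $t$ one writes $L=\sum_{k\ge 0}t^kp_k(\epsilon)$ with $p_k\in\mathbb C[\epsilon]$, $\deg p_k\le n$, $\deg p_0=n$; the polynomial $\mathcal E(L)=p_0$ is called the Euler part of $L$. A formal Fuchsian operator of order $n$ is any formal series of this form, without convergence assumption; such series are composed by the rule $p(\epsilon)\,t^m=t^m\,p(\epsilon+m)$. Two formal Fuchsian operators $L,M$ of the same order are formally $\mathscr F$-equivalent if there exist formal Fuchsian operators $H,K$ (of any orders) such that $MH=KL$ and $\gcd(\mathcal E(H),\mathcal E(L))=1$. A Fuchsian operator $M$ is called Liouville integrable if every germ, at any point $t_0\ne0$ sufficiently close to $0$, of a holomorphic solution of $Mu=0$ is obtained from germs of rational functions at $t_0$ by finitely many additions, multiplications, exponentiations and integrations (passages to a primitive). **Corollary.** Any Fuchsian operator $L$ is formally $\mathscr F$-equivalent to a Liouville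 integrable Fuchsian operator $M$. More precisely, let $n$ be the order of $L$. Then $M$ can be chosen Liouville integrable and of the form $$M=(\epsilon-\lambda_1+r_1(t))(\epsilon-\lambda_2+r_2(t))\cdots(\epsilon-\lambda_n+r_n(t)),$$ where $\lambda_1,\dots,\lambda_n$ are the roots of $\mathcal E(L)$, listed with multiplicities in a suitable order, and $r_1,\dots,r_n\in\mathbb C[t]$ are polynomials with $r_i(0)=0$ and $\deg r_i\le N$, where $N\ge0$ is the largest nonnegative integer that is a difference of two roots of $\mathcal E(L)$. -/

import Mathlib

open Polynomial Filter Topology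

noncomputable section

namespace Fuchs

/-- A formal operator `∑ₖ tᵏ pₖ(ε)`, where `ε = t d/dt`, given by the sequence of its coefficients
`pₖ ∈ ℂ[ε]` (written to the right of the powers of `t`). -/
abbrev FormalOperator : Type := ℕ → ℂ[X]

namespace FormalOperator

/-- Composition of formal operators. As `p(ε) tᵇ = tᵇ p(ε + b)`, one has
`(tᵃ p(ε)) (tᵇ q(ε)) = tᵃ⁺ᵇ p(ε + b) q(ε)`. -/
def comp (P Q : FormalOperator) : FormalOperator := fun j =>
  ∑ ab ∈ Finset.HasAntidiagonal.antidiagonal j, (P ab.1).comp (X + C (ab.2 : ℂ)) * Q ab.2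

/-- The identity operator. -/
def one : FormalOperator := fun k => if k = 0 then 1 else 0

/-- The ordered composition `P₁ P₂ ⋯ Pₙ` of a list of operators. -/
def prod (l : List FormalOperator) : FormalOperator := l.foldr comp one

/-- The Euler part `p₀ ∈ ℂ[ε]` of a formal operator. -/
def eulerPart (P : FormalOperator) : ℂ[X] := P 0

/-- The first order operator `ε - μ + r(t)` with `r ∈ ℂ[t]`. -/
def linearFactor (μ : ℂ) (r : ℂ[X]) : FormalOperator := fun k =>
  (if k = 0 then X - C μ else 0) + C (r.coeff k)

/-- Formal Fuchsian operators of order `n`: `deg pₖ ≤ n` for all `k`, and `deg p₀ = n`. -/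
def IsFuchsian (P : FormalOperator) (n : ℕ) : Prop :=
  (∀ k, (P k).degree ≤ (n : WithBot ℕ)) ∧ P.eulerPart.degree = (n : WithBot ℕ)

/-- Formal Fuchsian equivalence of two formal Fuchsian operators `L`, `M` of the same order:
`M H = K L` for formal Fuchsian operators `H`, `K` (of any orders) such that the Euler parts of
`H` and `L` are relatively prime. -/
def FEquivalent (L M : FormalOperator) : Prop :=
  (∃ n, L.IsFuchsian n ∧ M.IsFuchsian n) ∧
    ∃ H K : FormalOperator, (∃ m, H.IsFuchsian m) ∧ (∃ m, K.IsFuchsian m) ∧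
      M.comp H = K.comp L ∧ IsCoprime H.eulerPart L.eulerPart

end FormalOperator

/-- The Euler derivation `ε = t d/dt` on functions. -/
def eulerDeriv (u : ℂ → ℂ) : ℂ → ℂ := fun t => t * deriv u t

/-- A Fuchsian operator `L = ∑ᵢ aᵢ(t) εⁱ`, `0 ≤ i ≤ n`, at the origin: the coefficients are (functions
representing) holomorphic germs at `0`, and the leading one does not vanish at `0`. -/
structure FuchsianOperator where
  order : ℕ
  coeff : Fin (order + 1) → ℂ → ℂ
  analyticAt : ∀ i, AnalyticAt ℂ (coeff i) 0
  leading_ne_zero : coeff (Fin.last order) 0 ≠ 0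

/-- Germs at `t₀` obtained from rational functions without pole at `t₀` by finitely many sums,
products, exponentials and primitives. Division is allowed for rational functions only. -/
inductive IsLiouvillianAt (t₀ : ℂ) : (ℂ → ℂ) → Prop
  | rational (p q : ℂ[X]) (hq : q.eval t₀ ≠ 0) :
      IsLiouvillianAt t₀ (fun t => p.eval t / q.eval t)
  | add {f g : ℂ → ℂ} (hf : IsLiouvillianAt t₀ f) (hg : IsLiouvillianAt t₀ g) :
      IsLiouvillianAt t₀ (fun t => f t + g t)
  | mul {f g : ℂ → ℂ} (hf : IsLiouvillianAt t₀ f) (hg : IsLiouvillianAt t₀ g) :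
      IsLiouvillianAt t₀ (fun t => f t * g t)
  | exp {f : ℂ → ℂ} (hf : IsLiouvillianAt t₀ f) :
      IsLiouvillianAt t₀ (fun t => Complex.exp (f t))
  | primitive {f g : ℂ → ℂ} (hf : IsLiouvillianAt t₀ f)
      (hg : ∀ᶠ t in 𝓝 t₀, HasDerivAt g (f t) t) : IsLiouvillianAt t₀ g
  | congr {f g : ℂ → ℂ} (hf : IsLiouvillianAt t₀ f) (hg : f =ᶠ[𝓝 t₀] g) : IsLiouvillianAt t₀ g

namespace FuchsianOperator

/-- The value of `L u = ∑ᵢ aᵢ(t) εⁱ u` at `t`. -/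
def apply (L : FuchsianOperator) (u : ℂ → ℂ) (t : ℂ) : ℂ :=
  ∑ i : Fin (L.order + 1), L.coeff i t * (eulerDeriv^[(i : ℕ)] u) t

/-- The noncommutative Taylor expansion `L = ∑ₖ tᵏ pₖ(ε)`, obtained by expanding all the
coefficients of `L` in their Taylor series at `0`. -/
def taylor (L : FuchsianOperator) : FormalOperator := fun k =>
  ∑ i : Fin (L.order + 1), C (iteratedDeriv k (L.coeff i) 0 / (k.factorial : ℂ)) * X ^ (i : ℕ)

/-- `u` represents a germ at `t₀` of a holomorphic solution of `L u = 0`. -/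
def IsSolutionAt (L : FuchsianOperator) (t₀ : ℂ) (u : ℂ → ℂ) : Prop :=
  AnalyticAt ℂ u t₀ ∧ ∀ᶠ t in 𝓝 t₀, L.apply u t = 0

/-- `L` is Liouville integrable: in some punctured neighbourhood of the origin, all (germs of)
solutions of `L u = 0` are obtained from rational functions by iterated integration and
exponentiation. -/
def IsLiouvilleIntegrable (L : FuchsianOperator) : Prop :=
  ∃ ρ : ℝ, 0 < ρ ∧ ∀ t₀ : ℂ, t₀ ≠ 0 → ‖t₀‖ < ρ →
    ∀ u : ℂ → ℂ, L.IsSolutionAt t₀ u → IsLiouvillianAt t₀ u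

end FuchsianOperator

end Fuchs

end

noncomputable section

open Finset.HasAntidiagonal (antidiagonal)

namespace Fuchs

/-! The proof is by induction on the order, splitting off one root `μ` of the Euler part at a time.
If no `μ - k`, `k > 0`, is a root, then `bL = (ε - μ)E` for some power series `b`
(`exists_scalar_comp_eq`). By induction `MH = KE`, with `M` a product of first order factors.

To absorb `ε - μ`, put `H' = H + gE`, so that `MH' = (K + Mg)E`. It remains to make `(ε - μ + r)(K +
Mg)` divisible on the right by `ε - μ`, that is, to make it kill `t^μ` (`exists_prolongation`).
Write `K t^μ = t^μ κ`. Without `g`, the choice `r = -εκ/κ` would do. Truncating this series at the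
last resonance `N` makes `r` a polynomial and changes the required solution only beyond order `N`,
where `M(t^μ g)` can be prescribed freely (`exists_polynomial_gauge`).

The resulting product has polynomial coefficients, hence converges, and its solutions come from
successive first order equations solved by integrating factors (`of_firstOrder`). -/

/-- A triangular linear recurrence has a solution with prescribed initial segment. -/
theorem exists_triangular_solution (c : ℕ → ℕ → ℂ) (d init : ℕ → ℂ) (N : ℕ)
    (hc : ∀ k, N < k → c 0 k ≠ 0) :
    ∃ g : ℕ → ℂ, (∀ k ≤ N, g k = init k) ∧
      ∀ k, N < k → ∑ ab ∈ antidiagonal k, c ab.1 ab.2 * g ab.2 = d k := by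
  let g : ℕ → ℂ := WellFounded.fix (r := (· < ·)) Nat.lt_wfRel.wf
    (fun k ih => if k ≤ N then init k else
      (d k - ∑ b : Fin k, c (k - b) b * ih b b.2) / c 0 k)
  have hg : ∀ k, g k = if k ≤ N then init k else
      (d k - ∑ b : Fin k, c (k - b) b * g b) / c 0 k := fun k =>
    WellFounded.fix_eq _ _ _
  refine ⟨g, fun k hk => by rw [hg, if_pos hk], fun k hk => ?_⟩
  have h1 := hg k
  rw [if_neg (not_le.mpr hk), eq_div_iff (hc k hk)] at h1
  rw [← Finset.Nat.sum_antidiagonal_swap, Finset.Nat.sum_antidiagonal_eq_sum_range_succ_mk,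
    Finset.sum_range_succ]
  simp only [Prod.swap_prod_mk, Nat.sub_self]
  rw [Finset.sum_range (fun b => c (k - b) b * g b), mul_comm, h1]
  ring

/-! ### Composition, degrees and Euler parts of formal operators. -/

namespace FormalOperator

theorem comp_apply (P Q : FormalOperator) (j : ℕ) :
    P.comp Q j = ∑ ab ∈ antidiagonal j, (P ab.1).comp (X + C (ab.2 : ℂ)) * Q ab.2 := rfl

theorem comp_zero_apply (P Q : FormalOperator) : P.comp Q 0 = P 0 * Q 0 := by
  simp [comp_apply]

theorem add_comp (P Q R : FormalOperator) : (P + Q).comp R = P.comp R + Q.comp R := by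
  funext j
  simp only [comp_apply, Pi.add_apply, Polynomial.add_comp, add_mul, Finset.sum_add_distrib]

theorem comp_add (P Q R : FormalOperator) : P.comp (Q + R) = P.comp Q + P.comp R := by
  funext j
  simp only [comp_apply, Pi.add_apply, mul_add, Finset.sum_add_distrib]

theorem comp_assoc (P Q R : FormalOperator) : (P.comp Q).comp R = P.comp (Q.comp R) := by
  funext j
  simp only [comp_apply]
  have h1 : ∀ ab ∈ antidiagonal j,
      (∑ cd ∈ antidiagonal ab.1, (P cd.1).comp (X + C (cd.2 : ℂ)) * Q cd.2).comp
        (X + C (ab.2 : ℂ)) * R ab.2 =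
      ∑ cd ∈ antidiagonal ab.1, (P cd.1).comp (X + C ((cd.2 + ab.2 : ℕ) : ℂ)) *
        (Q cd.2).comp (X + C (ab.2 : ℂ)) * R ab.2 := by
    intro ab _
    rw [Polynomial.sum_comp, Finset.sum_mul]
    refine Finset.sum_congr rfl fun cd _ => ?_
    rw [Polynomial.mul_comp, Polynomial.comp_assoc]
    simp only [Polynomial.add_comp, X_comp, C_comp, Nat.cast_add, C_add]
    rw [add_assoc, add_comm (C (ab.2 : ℂ))]
  rw [Finset.sum_congr rfl h1]
  simp only [Finset.mul_sum]
  rw [Finset.sum_sigma', Finset.sum_sigma']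
  refine Finset.sum_bij' (fun x _ => ⟨(x.2.1, x.2.2 + x.1.2), (x.2.2, x.1.2)⟩)
    (fun x _ => ⟨(x.1.1 + x.2.1, x.2.2), (x.1.1, x.2.1)⟩) ?_ ?_ ?_ ?_ ?_
  · rintro ⟨⟨a, b⟩, ⟨c, d⟩⟩ h
    simp only [Finset.mem_sigma, Finset.HasAntidiagonal.mem_antidiagonal] at h ⊢
    obtain ⟨rfl, rfl⟩ := h
    exact ⟨by ring, trivial⟩
  · rintro ⟨⟨a, b⟩, ⟨c, d⟩⟩ h
    simp only [Finset.mem_sigma, Finset.HasAntidiagonal.mem_antidiagonal] at h ⊢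
    obtain ⟨rfl, rfl⟩ := h
    exact ⟨by ring, trivial⟩
  · rintro ⟨⟨a, b⟩, ⟨c, d⟩⟩ h
    simp only [Finset.mem_sigma, Finset.HasAntidiagonal.mem_antidiagonal] at h ⊢
    rw [h.2]
  · rintro ⟨⟨a, b⟩, ⟨c, d⟩⟩ h
    simp only [Finset.mem_sigma, Finset.HasAntidiagonal.mem_antidiagonal] at h ⊢
    rw [h.2]
  · rintro ⟨⟨a, b⟩, ⟨c, d⟩⟩ _
    simp only [mul_assoc]

/-- All coefficients have degree at most `m`. -/
def HasDegreeLE (P : FormalOperator) (m : ℕ) : Prop := ∀ k, (P k).natDegree ≤ m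

theorem HasDegreeLE.add {P Q : FormalOperator} {m n : ℕ} (hP : P.HasDegreeLE m)
    (hQ : Q.HasDegreeLE n) : (P + Q).HasDegreeLE (max m n) := fun k =>
  (natDegree_add_le _ _).trans (max_le_max (hP k) (hQ k))

theorem HasDegreeLE.comp {P Q : FormalOperator} {m n : ℕ} (hP : P.HasDegreeLE m)
    (hQ : Q.HasDegreeLE n) : (P.comp Q).HasDegreeLE (m + n) := fun k => by
  refine natDegree_sum_le_of_forall_le _ _ fun ab _ => natDegree_mul_le.trans ?_
  refine add_le_add ?_ (hQ _)
  rw [natDegree_comp, natDegree_X_add_C, mul_one]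
  exact hP _

theorem isFuchsian_iff {P : FormalOperator} {n : ℕ} :
    P.IsFuchsian n ↔ P.HasDegreeLE n ∧ (P 0).degree = n := by
  simp only [IsFuchsian, HasDegreeLE, natDegree_le_iff_degree_le, eulerPart]

theorem IsFuchsian.comp {P Q : FormalOperator} {m n : ℕ} (hP : P.IsFuchsian m)
    (hQ : Q.IsFuchsian n) : (P.comp Q).IsFuchsian (m + n) := by
  rw [isFuchsian_iff] at *
  refine ⟨hP.1.comp hQ.1, ?_⟩
  rw [comp_zero_apply, degree_mul, hP.2, hQ.2, Nat.cast_add]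

theorem IsFuchsian.add_of_lt {P Q : FormalOperator} {m n : ℕ} (hP : P.HasDegreeLE m)
    (hQ : Q.IsFuchsian n) (h : m < n) : (P + Q).IsFuchsian n := by
  rw [isFuchsian_iff] at *
  refine ⟨(max_eq_right h.le) ▸ hP.add hQ.1, ?_⟩
  have : (P 0).degree < (Q 0).degree := by
    rw [hQ.2]
    exact (natDegree_le_iff_degree_le.mp (hP 0)).trans_lt (by exact_mod_cast h)
  rw [Pi.add_apply, degree_add_eq_right_of_degree_lt this, hQ.2]

/-- The operator of multiplication by the formal power series with coefficients `g`. -/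
def scalar (g : ℕ → ℂ) : FormalOperator := fun k => C (g k)

theorem scalar_hasDegreeLE (g : ℕ → ℂ) : (scalar g).HasDegreeLE 0 := fun k => by
  simp [scalar]

theorem scalar_comp_apply (g : ℕ → ℂ) (P : FormalOperator) (j : ℕ) :
    (scalar g).comp P j = ∑ ab ∈ antidiagonal j, C (g ab.1) * P ab.2 := by
  simp [comp_apply, scalar]

/-- The operator `ε ^ d`. -/
def eulerPow (d : ℕ) : FormalOperator := fun k => if k = 0 then X ^ d else 0

theorem eulerPow_isFuchsian (d : ℕ) : (eulerPow d).IsFuchsian d := by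
  rw [isFuchsian_iff]
  refine ⟨fun k => ?_, by simp [eulerPow]⟩
  by_cases hk : k = 0 <;> simp [eulerPow, hk]

theorem linearFactor_comp_apply (μ : ℂ) (r : ℂ[X]) (P : FormalOperator) (j : ℕ) :
    (linearFactor μ r).comp P j = (X + C (j : ℂ) - C μ) * P j +
      ∑ ab ∈ antidiagonal j, C (r.coeff ab.1) * P ab.2 := by
  simp only [comp_apply, linearFactor, Polynomial.add_comp, C_comp, add_mul,
    Finset.sum_add_distrib]
  congr 1
  rw [Finset.sum_eq_single (0, j)]
  · simp
  · rintro ⟨a, b⟩ hab hne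
    have ha : a ≠ 0 := by
      rintro rfl
      simp at hab
      exact hne (by rw [hab])
    simp [ha]
  · simp

theorem linearFactor_isFuchsian (μ : ℂ) (r : ℂ[X]) : (linearFactor μ r).IsFuchsian 1 := by
  rw [isFuchsian_iff]
  constructor
  · intro k
    refine (natDegree_add_le _ _).trans ?_
    rw [natDegree_C]
    split_ifs <;> simp
  · simp only [linearFactor, if_true]
    rw [sub_add, ← C_sub, degree_X_sub_C]; rfl

/-! ### Divisibility by `ε - μ`, and the polynomial gauge. -/

/-- An operator annihilating `t ^ μ` is divisible by `ε - μ` on the right. -/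
theorem exists_comp_linearFactor_eq {P : FormalOperator} {m : ℕ} (hP : P.HasDegreeLE m) {μ : ℂ}
    (h : ∀ j, (P j).eval μ = 0) :
    ∃ Q : FormalOperator, Q.HasDegreeLE m ∧ Q.comp (linearFactor μ 0) = P := by
  refine ⟨fun j => P j /ₘ (X - C μ), fun j => ?_, ?_⟩
  · rw [natDegree_divByMonic _ (monic_X_sub_C _)]
    exact (Nat.sub_le _ _).trans (hP j)
  · funext j
    rw [comp_apply, Finset.sum_eq_single (j, 0)]
    · simp only [Nat.cast_zero, C_0, add_zero, comp_X, linearFactor, if_true, coeff_zero]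
      rw [mul_comm, mul_divByMonic_eq_iff_isRoot]
      exact h j
    · rintro ⟨a, b⟩ hab hne
      have hb : b ≠ 0 := by
        rintro rfl
        simp at hab
        exact hne (by rw [hab])
      simp [linearFactor, hb]
    · simp

/-- A formal Fuchsian operator has, up to a scalar factor, a left factor `ε - μ` for each root `μ`
of its Euler part which is minimal modulo the integers. -/
theorem exists_scalar_comp_eq {L : FormalOperator} {n : ℕ} (hL : L.IsFuchsian (n + 1)) {μ : ℂ}
    (hμ : (L 0).eval μ = 0) (hmin : ∀ k : ℕ, 0 < k → (L 0).eval (μ - k) ≠ 0) :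
    ∃ (b : ℕ → ℂ) (E : FormalOperator), E.IsFuchsian n ∧ L 0 = (X - C μ) * E 0 ∧
      (scalar b).comp L = (linearFactor μ 0).comp E := by
  -- Since `(ε - μ) t^j = t^j (ε + j - μ)`, left divisibility means that the `j`-th coefficient of
  -- `bL` vanishes at `μ - j`. The pivots `L₀(μ - j)` are nonzero by minimality of `μ`.
  obtain ⟨b, hb0, hb⟩ := exists_triangular_solution
    (fun a b => (L a).eval (μ - (a + b : ℕ))) 0 1 0 (by simpa using hmin)
  have hb0 : b 0 = 1 := hb0 0 le_rfl
  have hroot : ∀ j : ℕ, ((scalar b).comp L j).eval (μ - j) = 0 := by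
    intro j
    rcases Nat.eq_zero_or_pos j with rfl | hj
    · simp [comp_zero_apply, hμ]
    · have := hb j hj
      rw [scalar_comp_apply, eval_finsetSum, ← Finset.Nat.sum_antidiagonal_swap]
      rw [Pi.zero_apply] at this
      rw [← this]
      refine Finset.sum_congr rfl fun ab hab => ?_
      rw [Finset.HasAntidiagonal.mem_antidiagonal.mp hab, eval_mul, Prod.fst_swap, Prod.snd_swap,
        eval_C, mul_comm]
  let E : FormalOperator := fun j => (scalar b).comp L j /ₘ (X - C (μ - j))
  have hE : ∀ j : ℕ, (X - C (μ - j)) * E j = (scalar b).comp L j := fun j =>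
    mul_divByMonic_eq_iff_isRoot.mpr (hroot j)
  have hE0 : L 0 = (X - C μ) * E 0 := by
    have := hE 0
    rw [comp_zero_apply] at this
    simpa [scalar, hb0] using this.symm
  rw [isFuchsian_iff] at hL
  refine ⟨b, E, ?_, hE0, ?_⟩
  · rw [isFuchsian_iff]
    constructor
    · intro k
      have h1 := ((scalar_hasDegreeLE b).comp hL.1) k
      simp only [E]
      rw [natDegree_divByMonic _ (monic_X_sub_C _), natDegree_X_sub_C]
      omega
    · have h1 := hL.2
      have hne : E 0 ≠ 0 := by
        intro h0
        rw [hE0, h0, mul_zero, degree_zero] at h1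
        exact WithBot.natCast_ne_bot _ h1.symm
      rw [hE0, degree_mul, degree_X_sub_C, degree_eq_natDegree hne] at h1
      rw [degree_eq_natDegree hne]
      have : 1 + (E 0).natDegree = n + 1 := by exact_mod_cast h1
      congr 1
      omega
  · funext j
    rw [linearFactor_comp_apply, ← hE j, C_sub]
    simp only [coeff_zero, C_0, zero_mul, Finset.sum_const_zero, add_zero]
    ring

/-- The functions `t ^ μ κ(t)` and `M (t ^ μ g(t))`, `g` formal, sum up to a solution of
some equation `(ε - μ + r) φ = 0` with a polynomial `r`, whose degree is bounded in terms of the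
Euler part of `M`. -/
theorem exists_polynomial_gauge (M : FormalOperator) (κ : ℕ → ℂ) (μ : ℂ) (N : ℕ)
    (hM : ∀ k, N < k → (M 0).eval (μ + k) ≠ 0) (hκ : κ 0 ≠ 0) :
    ∃ (r : ℂ[X]) (g φ : ℕ → ℂ), r.natDegree ≤ N ∧ r.eval 0 = 0 ∧ g 0 = 0 ∧
      (∀ k, φ k = κ k + ∑ ab ∈ antidiagonal k, (M ab.1).eval (μ + ab.2) * g ab.2) ∧
      ∀ k : ℕ, k * φ k + ∑ ab ∈ antidiagonal k, r.coeff ab.1 * φ ab.2 = 0 := by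
  -- Minus the logarithmic Euler derivative of `κ`, so that `(ε + ρ)κ = 0`.
  let ρ : PowerSeries ℂ := -(PowerSeries.mk fun k => (k : ℂ) * κ k) * (PowerSeries.mk κ)⁻¹
  have hρ : ρ * PowerSeries.mk κ = -(PowerSeries.mk fun k => (k : ℂ) * κ k) := by
    rw [mul_assoc, PowerSeries.inv_mul_cancel _ (by simpa using hκ), mul_one]
  have hρk : ∀ k : ℕ, k * κ k +
      ∑ ab ∈ antidiagonal k, PowerSeries.coeff ab.1 ρ * κ ab.2 = 0 := by
    intro k
    have := congrArg (PowerSeries.coeff k) hρ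
    simp only [PowerSeries.coeff_mul, PowerSeries.coeff_mk, map_neg] at this
    rw [this, add_neg_cancel]
  let r : ℂ[X] := PowerSeries.trunc (N + 1) ρ
  have hr : ∀ k ≤ N, r.coeff k = PowerSeries.coeff k ρ := fun k hk => by
    simp only [r]
    rw [PowerSeries.coeff_trunc, if_pos (Nat.lt_succ_of_le hk)]
  have hr0 : r.coeff 0 = 0 := by
    rw [hr 0 (Nat.zero_le _)]
    have := hρk 0
    simpa [hκ] using this
  -- Up to order `N` the series `κ` already solves the equation with `r`; beyond, the pivot is `k ≠
  -- 0`, as `r(0) = 0`.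
  obtain ⟨φ, hφκ, hφ⟩ := exists_triangular_solution
    (fun a b => r.coeff a + if a = 0 then (b : ℂ) else 0) 0 κ N
    (fun k hk => by simpa [hr0] using (Nat.zero_lt_of_lt hk).ne')
  -- `φ - κ` vanishes through order `N`, so `g` can vanish there too and no resonance of `M` is met.
  obtain ⟨g, hg0, hg⟩ := exists_triangular_solution
    (fun a b => (M a).eval (μ + b)) (φ - κ) 0 N hM
  refine ⟨r, g, φ, Nat.lt_succ_iff.mp (PowerSeries.natDegree_trunc_lt _ _), ?_,
    hg0 0 (Nat.zero_le _), fun k => ?_, fun k => ?_⟩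
  · rw [← coeff_zero_eq_eval_zero, hr0]
  · rcases le_or_gt k N with hk | hk
    · rw [Finset.sum_eq_zero, hφκ k hk, add_zero]
      intro ab hab
      rw [hg0 _ ((Finset.HasAntidiagonal.antidiagonal.snd_le hab).trans hk), Pi.zero_apply, mul_zero]
    · rw [hg k hk]
      simp
  · rcases le_or_gt k N with hk | hk
    · rw [← hρk k, hφκ k hk]
      congr 1
      refine Finset.sum_congr rfl fun ab hab => ?_
      rw [hr _ ((Finset.HasAntidiagonal.antidiagonal.fst_le hab).trans hk),
        hφκ _ ((Finset.HasAntidiagonal.antidiagonal.snd_le hab).trans hk)]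
    · rw [← Pi.zero_apply (M := fun _ => ℂ) k, ← hφ k hk, add_comm]
      simp only [add_mul, Finset.sum_add_distrib]
      congr 1
      rw [Finset.sum_eq_single (0, k)]
      · simp
      · rintro ⟨a, b⟩ hab hne
        have ha : a ≠ 0 := by
          rintro rfl
          simp at hab
          exact hne (by rw [hab])
        simp [ha]
      · simp

/-! ### Products of first order factors, and the choice of roots. -/

/-- The composition of the operators `ε - μ + r` over a list of pairs `(μ, r)`. -/
def linearProd (l : List (ℂ × ℂ[X])) : FormalOperator :=
  prod (l.map fun x => linearFactor x.1 x.2)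

theorem linearProd_cons (x : ℂ × ℂ[X]) (l : List (ℂ × ℂ[X])) :
    linearProd (x :: l) = (linearFactor x.1 x.2).comp (linearProd l) := rfl

theorem one_isFuchsian : one.IsFuchsian 0 := by
  rw [isFuchsian_iff]
  refine ⟨fun k => ?_, by simp [one]⟩
  by_cases hk : k = 0 <;> simp [one, hk]

theorem linearProd_isFuchsian (l : List (ℂ × ℂ[X])) : (linearProd l).IsFuchsian l.length := by
  induction l with
  | nil => exact one_isFuchsian
  | cons x l ih =>
    rw [linearProd_cons, List.length_cons, add_comm]
    exact (linearFactor_isFuchsian _ _).comp ih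

theorem linearProd_zero (l : List (ℂ × ℂ[X])) (h : ∀ x ∈ l, x.2.eval 0 = 0) :
    linearProd l 0 = ((l.map Prod.fst : Multiset ℂ).map fun μ => X - C μ).prod := by
  induction l with
  | nil => simp [linearProd, prod, one]
  | cons x l ih =>
    have hx : x.2.coeff 0 = 0 := by
      rw [coeff_zero_eq_eval_zero]
      exact h x List.mem_cons_self
    rw [linearProd_cons, comp_zero_apply, ih fun y hy => h y (List.mem_cons_of_mem _ hy)]
    simp [linearFactor, hx]

/-- A root of least real part works, since subtracting `k > 0` lowers the real part. -/
theorem exists_minimal_root {p : ℂ[X]} (hp : p.degree ≠ 0) (hp0 : p ≠ 0) :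
    ∃ μ, p.eval μ = 0 ∧ ∀ k : ℕ, 0 < k → p.eval (μ - k) ≠ 0 := by
  obtain ⟨z, hz⟩ := IsAlgClosed.exists_root p hp
  obtain ⟨μ, hμ, hmin⟩ := p.roots.toFinset.exists_min_image Complex.re
    ⟨z, by simpa [hp0] using hz⟩
  simp only [Multiset.mem_toFinset, mem_roots hp0, IsRoot.def] at hμ hmin
  refine ⟨μ, hμ, fun k hk h => ?_⟩
  have := hmin _ h
  simp only [Complex.sub_re, Complex.natCast_re] at this
  have : (0 : ℝ) < k := by exact_mod_cast hk
  linarith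

theorem exists_max_resonance {p : ℂ[X]} (hp0 : p ≠ 0) {μ : ℂ} (hμ : p.eval μ = 0) :
    ∃ N : ℕ, p.eval (μ + N) = 0 ∧ ∀ k, N < k → p.eval (μ + k) ≠ 0 := by
  have hfin : {k : ℕ | p.eval (μ + k) = 0}.Finite := by
    refine Set.Finite.of_finite_image (f := fun k : ℕ => μ + (k : ℂ)) ?_ ?_
    · refine p.roots.toFinset.finite_toSet.subset ?_
      rintro _ ⟨k, hk, rfl⟩
      simpa [hp0] using hk
    · intro a _ b _ h
      simpa using h
  obtain ⟨N, hN, hmax⟩ := hfin.toFinset.exists_max_image id ⟨0, by simpa using hμ⟩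
  refine ⟨N, by simpa using hN, fun k hk h => ?_⟩
  exact absurd (hmax k (by simpa using h)) (not_le.mpr hk)

/-! ### The induction on the order. -/

/-- The inductive step: prolonging an intertwining relation from `E` to `(ε - μ) E`. -/
theorem exists_prolongation {M H K E : FormalOperator} {n : ℕ} (hM : M.IsFuchsian n)
    (hE : E.IsFuchsian n) (hH : ∃ m, H.HasDegreeLE m) (hK : ∃ m, K.HasDegreeLE m)
    (hMH : M.comp H = K.comp E) (hcop : IsCoprime (H 0) (E 0))
    (hME : ∃ c : ℂ, E 0 = C c * M 0) (μ : ℂ) (N : ℕ)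
    (hN : ∀ k, N < k → (E 0).eval (μ + k) ≠ 0) :
    ∃ (r : ℂ[X]) (H' K' : FormalOperator), r.natDegree ≤ N ∧ r.eval 0 = 0 ∧
      (∃ m, H'.HasDegreeLE m) ∧ (∃ m, K'.HasDegreeLE m) ∧
      ((linearFactor μ r).comp M).comp H' = K'.comp ((linearFactor μ 0).comp E) ∧
      IsCoprime (H' 0) ((X - C μ) * E 0) := by
  -- Adding `ME = ME` replaces `(H, K)` by `(H + E, K + M)`. If `H₀(μ) = 0`, coprimality gives
  -- `E₀(μ) ≠ 0`, so the new value at `μ` is nonzero.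
  wlog hμ : (H 0).eval μ ≠ 0 generalizing H K with key
  · obtain ⟨mH, hH⟩ := hH
    obtain ⟨mK, hK⟩ := hK
    rw [not_not] at hμ
    refine @key (H + E) (K + M) ⟨_, hH.add (isFuchsian_iff.mp hE).1⟩
      ⟨_, hK.add (isFuchsian_iff.mp hM).1⟩ ?_ ?_ ?_
    · rw [comp_add, add_comp, hMH]
    · simpa using hcop.add_mul_left_left 1
    · rw [Pi.add_apply, eval_add, hμ, zero_add]
      intro h
      obtain ⟨a, b, hab⟩ := hcop
      have := congrArg (eval μ) hab
      simp [hμ, h] at this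
  · obtain ⟨mH, hH⟩ := hH
    obtain ⟨mK, hK⟩ := hK
    obtain ⟨c, hc⟩ := hME
    have hE0 : E 0 ≠ 0 := by
      intro h
      have := (isFuchsian_iff.mp hE).2
      rw [h, degree_zero] at this
      exact WithBot.natCast_ne_bot _ this.symm
    have hM0 : M 0 ≠ 0 := fun h => hE0 (by rw [hc, h, mul_zero])
    -- From `M₀H₀ = K₀E₀` and `E₀ = cM₀` follows `H₀ = cK₀`.
    have hKμ : (K 0).eval μ ≠ 0 := by
      have h1 := congrFun hMH 0
      rw [comp_zero_apply, comp_zero_apply, hc, mul_comm (C c), ← mul_assoc, mul_comm (K 0),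
        mul_assoc] at h1
      have h2 := mul_left_cancel₀ hM0 h1
      intro h
      exact hμ (by rw [h2, eval_mul, h, zero_mul])
    obtain ⟨r, g, φ, hrN, hr0, hg0, hφ, hrφ⟩ := exists_polynomial_gauge M
      (fun k => (K k).eval μ) μ N (fun k hk h => hN k hk (by rw [hc, eval_mul, h, mul_zero])) hKμ
    have hdeg := (isFuchsian_iff.mp (linearFactor_isFuchsian μ r)).1.comp
      (hK.add ((isFuchsian_iff.mp hM).1.comp (scalar_hasDegreeLE g)))
    -- `(K + Mg) t^μ = t^μ φ`, and `ε - μ + r` kills this by the choice of `φ`.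
    obtain ⟨Q, hQ, hQeq⟩ := exists_comp_linearFactor_eq hdeg (μ := μ) (by
      have heval : ∀ k, ((K + M.comp (scalar g)) k).eval μ = φ k := by
        intro k
        rw [hφ, Pi.add_apply, eval_add, comp_apply, eval_finsetSum]
        simp [scalar]
      intro j
      rw [linearFactor_comp_apply, eval_add, eval_mul, heval, eval_finsetSum, ← hrφ j]
      simp only [eval_mul, eval_C, heval, eval_sub, eval_add, eval_X]
      ring)
    refine ⟨r, H + (scalar g).comp E, Q, hrN, hr0,
      ⟨_, hH.add ((scalar_hasDegreeLE g).comp (isFuchsian_iff.mp hE).1)⟩, ⟨_, hQ⟩, ?_, ?_⟩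
    · rw [comp_assoc, comp_add, hMH, ← comp_assoc M, ← add_comp, ← comp_assoc, ← comp_assoc, hQeq]
    · rw [Pi.add_apply, comp_zero_apply]
      simp only [scalar, hg0, C_0, zero_mul, add_zero]
      refine IsCoprime.mul_right ?_ hcop
      rw [isCoprime_comm, (irreducible_X_sub_C μ).coprime_iff_not_dvd, dvd_iff_isRoot]
      exact hμ

/-- Every formal Fuchsian operator is intertwined with a product of polynomial operators of first
order. -/
theorem exists_intertwining_linearProd (n : ℕ) (L : FormalOperator) (hL : L.IsFuchsian n) :
    ∃ l : List (ℂ × ℂ[X]), (l.map Prod.fst : Multiset ℂ) = (L 0).roots ∧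
      (∀ x ∈ l, x.2.eval 0 = 0 ∧ ∃ μ ∈ (L 0).roots, ∃ ν ∈ (L 0).roots, ∃ j : ℕ,
        μ - ν = (j : ℂ) ∧ x.2.natDegree ≤ j) ∧
      ∃ H K : FormalOperator, (∃ m, H.HasDegreeLE m) ∧ (∃ m, K.HasDegreeLE m) ∧
        (linearProd l).comp H = K.comp L ∧ IsCoprime (H 0) (L 0) := by
  induction n generalizing L with
  | zero =>
    obtain ⟨hL1, hL2⟩ := isFuchsian_iff.mp hL
    -- In order `0` the empty product and `H = L`, `K = 1` suffice: the Euler part is a nonzero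
    -- constant, hence coprime to itself.
    refine ⟨[], ?_, by simp, L, one, ⟨_, hL1⟩, ⟨_, (isFuchsian_iff.mp one_isFuchsian).1⟩, rfl, ?_⟩
    · rw [eq_C_of_degree_eq_zero hL2, roots_C]; rfl
    · exact isCoprime_self.mpr (isUnit_iff_degree_eq_zero.mpr hL2)
  | succ n ih =>
    obtain ⟨hL1, hL2⟩ := isFuchsian_iff.mp hL
    have hL0 : L 0 ≠ 0 := by
      intro h
      rw [h, degree_zero] at hL2
      exact WithBot.natCast_ne_bot _ hL2.symm
    obtain ⟨μ, hμ, hmin⟩ := exists_minimal_root (p := L 0)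
      (by rw [hL2]; exact_mod_cast n.succ_ne_zero) hL0
    obtain ⟨b, E, hE, hLE, hbL⟩ := exists_scalar_comp_eq hL hμ hmin
    -- `N` is the difference of the roots `μ + N` and `μ`, whence the degree bound; as `E₀` divides
    -- `L₀`, `E₀(μ + k) ≠ 0` for `k > N`.
    obtain ⟨N, hN, hNmax⟩ := exists_max_resonance hL0 hμ
    obtain ⟨l, hl, hlr, H, K, hH, hK, hHK, hcop⟩ := ih E hE
    have hroots : (L 0).roots = μ ::ₘ (E 0).roots := by
      rw [hLE, roots_mul (hLE ▸ hL0), roots_X_sub_C]; rfl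
    have hprod : E 0 = C (E 0).leadingCoeff * linearProd l 0 := by
      rw [linearProd_zero l fun x hx => (hlr x hx).1, hl]
      exact (IsAlgClosed.splits (E 0)).eq_prod_roots
    have hlen : l.length = n := by
      have h1 := congrArg Multiset.card hl
      rw [Multiset.coe_card, List.length_map, ← (IsAlgClosed.splits (E 0)).natDegree_eq_card_roots] at h1
      rw [h1]
      exact natDegree_eq_of_degree_eq_some (isFuchsian_iff.mp hE).2
    obtain ⟨r, H', K', hrN, hr0, hH', ⟨m, hK'⟩, hHK', hcop'⟩ := exists_prolongation
      (hlen ▸ linearProd_isFuchsian l) hE hH hK hHK hcop ⟨_, hprod⟩ μ N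
      (fun k hk h => hNmax k hk (by rw [hLE, eval_mul, h, mul_zero]))
    refine ⟨(μ, r) :: l, ?_, ?_, H', K'.comp (scalar b), hH',
      ⟨_, hK'.comp (scalar_hasDegreeLE b)⟩, ?_, hLE ▸ hcop'⟩
    · rw [hroots, List.map_cons, ← Multiset.cons_coe, hl]
    · rintro x hx
      rcases List.mem_cons.mp hx with rfl | hx
      · exact ⟨hr0, μ + N, by simpa [hL0] using hN, μ, by simpa [hL0] using hμ, N, by ring, hrN⟩
      · obtain ⟨h0, α, hα, β, hβ, j, h⟩ := hlr x hx
        rw [hroots]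
        exact ⟨h0, α, Multiset.mem_cons_of_mem hα, β, Multiset.mem_cons_of_mem hβ, j, h⟩
    · rw [linearProd_cons, hHK', comp_assoc, hbL]

/-- The induction bounds the degrees of `H` and `K` without controlling their Euler parts. Adding
`ε^d L` to `H` and `M ε^d` to `K`, with `d` large, makes both Fuchsian and preserves the relation
and coprimality to `L₀`. -/
theorem fEquivalent_of_intertwining {L M H K : FormalOperator} {n : ℕ} (hL : L.IsFuchsian n)
    (hM : M.IsFuchsian n) (hH : ∃ m, H.HasDegreeLE m) (hK : ∃ m, K.HasDegreeLE m)
    (hMH : M.comp H = K.comp L) (hcop : IsCoprime (H 0) (L 0)) : FEquivalent L M := by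
  obtain ⟨m, hH⟩ := hH
  obtain ⟨m', hK⟩ := hK
  have hd := eulerPow_isFuchsian (max m m' + 1)
  refine ⟨⟨n, hL, hM⟩, H + (eulerPow (max m m' + 1)).comp L, K + M.comp (eulerPow (max m m' + 1)),
    ⟨_, IsFuchsian.add_of_lt hH (hd.comp hL) (by omega)⟩,
    ⟨_, IsFuchsian.add_of_lt hK (hM.comp hd) (by omega)⟩, ?_, ?_⟩
  · rw [comp_add, add_comp, hMH, comp_assoc]
  · simp only [eulerPart, Pi.add_apply, comp_zero_apply]
    exact hcop.add_mul_right_left _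

end FormalOperator

/-! ### Action on functions, and convergence of the products. -/

/-- The value of `p(ε) u` at `t`. -/
def polyAct (u : ℂ → ℂ) (t : ℂ) : ℂ[X] →ₗ[ℂ] ℂ :=
  Polynomial.lsum fun i => LinearMap.mulRight ℂ (eulerDeriv^[i] u t)

theorem polyAct_apply (u : ℂ → ℂ) (t : ℂ) (p : ℂ[X]) :
    polyAct u t p = p.sum fun i a => a * eulerDeriv^[i] u t := rfl

theorem polyAct_monomial (u : ℂ → ℂ) (t : ℂ) (i : ℕ) (a : ℂ) :
    polyAct u t (monomial i a) = a * eulerDeriv^[i] u t := by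
  rw [polyAct_apply, sum_monomial_index a (fun i a => a * eulerDeriv^[i] u t) (zero_mul _)]

theorem polyAct_C_mul (u : ℂ → ℂ) (t a : ℂ) (p : ℂ[X]) :
    polyAct u t (C a * p) = a * polyAct u t p := by
  rw [C_mul', map_smul, smul_eq_mul]

theorem polyAct_one (u : ℂ → ℂ) (t : ℂ) : polyAct u t 1 = u t := by
  simpa using polyAct_monomial u t 0 1

theorem analyticAt_eulerDeriv {u : ℂ → ℂ} {t : ℂ} (hu : AnalyticAt ℂ u t) :
    AnalyticAt ℂ (eulerDeriv u) t := analyticAt_id.mul hu.deriv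

theorem analyticAt_iterate_eulerDeriv {u : ℂ → ℂ} {t : ℂ} (hu : AnalyticAt ℂ u t) (i : ℕ) :
    AnalyticAt ℂ (eulerDeriv^[i] u) t := by
  induction i with
  | zero => exact hu
  | succ i ih =>
    rw [Function.iterate_succ_apply']
    exact analyticAt_eulerDeriv ih

theorem hasDerivAt_polyAct {u : ℂ → ℂ} {t : ℂ} (hu : AnalyticAt ℂ u t) (p : ℂ[X]) :
    ∃ d, HasDerivAt (fun s => polyAct u s p) d t ∧ t * d = polyAct u t (X * p) := by
  induction p using Polynomial.induction_on' with
  | add p q hp hq =>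
    obtain ⟨d, hd, hdt⟩ := hp
    obtain ⟨e, he, het⟩ := hq
    refine ⟨d + e, ?_, by rw [mul_add, hdt, het, mul_add, map_add]⟩
    simp only [map_add]
    exact hd.add he
  | monomial i a =>
    refine ⟨a * deriv (eulerDeriv^[i] u) t, ?_, ?_⟩
    · simp only [polyAct_monomial]
      exact (analyticAt_iterate_eulerDeriv hu i).differentiableAt.hasDerivAt.const_mul a
    · rw [X_mul_monomial, polyAct_monomial, Function.iterate_succ_apply', eulerDeriv]
      ring

/-- The outer variable of `S` is `t`, the inner one `ε`; this is the product rule `ε t^k = t^k (ε +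
k)`, summed over `k`. -/
theorem eulerDeriv_polyAct_eval {u : ℂ → ℂ} {t : ℂ} (hu : AnalyticAt ℂ u t) (S : ℂ[X][X]) :
    eulerDeriv (fun s => polyAct u s (S.eval (C s))) t =
      polyAct u t (X * S.eval (C t) + C t * S.derivative.eval (C t)) := by
  suffices h : ∃ d, HasDerivAt (fun s => polyAct u s (S.eval (C s))) d t ∧
      t * d = polyAct u t (X * S.eval (C t) + C t * S.derivative.eval (C t)) by
    obtain ⟨d, hd, h⟩ := h
    rw [← h, ← hd.deriv]; rfl
  induction S using Polynomial.induction_on' with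
  | add S T hS hT =>
    obtain ⟨d, hd, hdt⟩ := hS
    obtain ⟨e, he, het⟩ := hT
    refine ⟨d + e, ?_, ?_⟩
    · simp only [eval_add, map_add]
      exact hd.add he
    · rw [mul_add, hdt, het, ← map_add]
      congr 1
      simp only [eval_add, derivative_add]
      ring
  | monomial k p =>
    obtain ⟨d, hd, hdt⟩ := hasDerivAt_polyAct hu p
    have heval : ∀ s : ℂ, (monomial k p).eval (C s) = C (s ^ k) * p := fun s => by
      rw [eval_monomial, C_pow, mul_comm]
    refine ⟨k * t ^ (k - 1) * polyAct u t p + t ^ k * d, ?_, ?_⟩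
    · simp only [heval, polyAct_C_mul]
      exact (hasDerivAt_pow k t).mul hd
    · rw [heval, derivative_monomial, eval_monomial, map_add, mul_left_comm, polyAct_C_mul,
        ← hdt, polyAct_C_mul]
      have : p * (k : ℂ[X]) * C t ^ (k - 1) = C (k * t ^ (k - 1)) * p := by
        rw [C_mul, C_pow, map_natCast]; ring
      rw [this, polyAct_C_mul]
      ring

/-- The operator `ε - μ + r` acting on functions. -/
def firstOrder (x : ℂ × ℂ[X]) (u : ℂ → ℂ) : ℂ → ℂ := fun t =>
  eulerDeriv u t - x.1 * u t + x.2.eval t * u t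

/-- The composition of the operators `ε - μ + r` acting on functions. -/
def firstOrderProd (l : List (ℂ × ℂ[X])) (u : ℂ → ℂ) : ℂ → ℂ := l.foldr firstOrder u

theorem analyticAt_firstOrder {x : ℂ × ℂ[X]} {u : ℂ → ℂ} {t : ℂ} (hu : AnalyticAt ℂ u t) :
    AnalyticAt ℂ (firstOrder x u) t :=
  ((analyticAt_eulerDeriv hu).sub (analyticAt_const.mul hu)).add
    ((AnalyticOnNhd.eval_polynomial x.2 t (Set.mem_univ t)).mul hu)

theorem analyticAt_firstOrderProd {l : List (ℂ × ℂ[X])} {u : ℂ → ℂ} {t : ℂ}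
    (hu : AnalyticAt ℂ u t) : AnalyticAt ℂ (firstOrderProd l u) t := by
  induction l with
  | nil => exact hu
  | cons x l ih => exact analyticAt_firstOrder ih

/-- A product of operators of first order is polynomial in `t`, and acts on functions as the
composition of its factors. -/
theorem exists_polynomial_linearProd (l : List (ℂ × ℂ[X])) :
    ∃ S : ℂ[X][X], (∀ k, S.coeff k = FormalOperator.linearProd l k) ∧
      ∀ (u : ℂ → ℂ) (t : ℂ), AnalyticAt ℂ u t →
        polyAct u t (S.eval (C t)) = firstOrderProd l u t := by
  induction l with
  | nil =>
    refine ⟨1, fun k => ?_, fun u t _ => ?_⟩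
    · simp [FormalOperator.linearProd, FormalOperator.prod, FormalOperator.one, coeff_one]
    · rw [eval_one, polyAct_one]; rfl
  | cons x l ih =>
    obtain ⟨S, hS, hSu⟩ := ih
    refine ⟨(C X - C (C x.1)) * S + X * derivative S + x.2.map C * S, fun k => ?_,
      fun u t hu => ?_⟩
    · rw [FormalOperator.linearProd_cons, FormalOperator.linearFactor_comp_apply, coeff_add,
        coeff_add, ← C_sub, coeff_C_mul, coeff_mul (x.2.map C)]
      simp only [coeff_map, ← hS]
      have : (X * derivative S).coeff k = C (k : ℂ) * S.coeff k := by
        cases k with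
        | zero => simp
        | succ k =>
          rw [coeff_X_mul, coeff_derivative]
          simp
          ring
      rw [this]
      ring
    · have h1 : firstOrderProd l u =ᶠ[𝓝 t] fun s => polyAct u s (S.eval (C s)) := by
        filter_upwards [hu.eventually_analyticAt] with s hs
        exact (hSu u s hs).symm
      have h2 : eulerDeriv (firstOrderProd l u) t =
          eulerDeriv (fun s => polyAct u s (S.eval (C s))) t := by
        rw [eulerDeriv, eulerDeriv, h1.deriv_eq]
      have h3 : ((C X - C (C x.1)) * S + X * derivative S + x.2.map C * S).eval (C t) =
          (X * S.eval (C t) + C t * S.derivative.eval (C t)) + (C (-x.1) * S.eval (C t) +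
            C (x.2.eval t) * S.eval (C t)) := by
        have : (x.2.map C).eval (C t) = C (x.2.eval t) := by
          rw [eval_map, eval₂_at_apply]
        simp only [eval_add, eval_mul, eval_sub, eval_C, eval_X, this, C_neg]
        ring
      rw [h3, map_add, ← eulerDeriv_polyAct_eval hu, map_add, polyAct_C_mul, polyAct_C_mul,
        hSu u t hu, ← h2]
      change _ = eulerDeriv (firstOrderProd l u) t - x.1 * firstOrderProd l u t +
        x.2.eval t * firstOrderProd l u t
      ring

theorem iteratedDeriv_polynomial_eval_zero (Q : ℂ[X]) (k : ℕ) :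
    iteratedDeriv k (fun t => Q.eval t) 0 / (k.factorial : ℂ) = Q.coeff k := by
  have h : ∀ k, iteratedDeriv k (fun t => Q.eval t) = fun t => (derivative^[k] Q).eval t := by
    intro k
    induction k with
    | zero => rfl
    | succ k ih =>
      rw [iteratedDeriv_succ, ih, Function.iterate_succ_apply']
      funext t
      exact Polynomial.deriv _
  rw [h]
  beta_reduce
  rw [← coeff_zero_eq_eval_zero, coeff_iterate_derivative, zero_add, Nat.descFactorial_self,
    nsmul_eq_mul, mul_div_cancel_left₀]
  exact_mod_cast k.factorial_ne_zero

/-- Passes from expansion in powers of `t` to expansion in powers of `ε`. -/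
theorem exists_eval_eq_coeff_eval (S : ℂ[X][X]) (i : ℕ) :
    ∃ Q : ℂ[X], (∀ t, Q.eval t = (S.eval (C t)).coeff i) ∧
      ∀ k, Q.coeff k = (S.coeff k).coeff i := by
  refine ⟨∑ k ∈ Finset.range (S.natDegree + 1), monomial k ((S.coeff k).coeff i),
    fun t => ?_, fun k => ?_⟩
  · rw [eval_finsetSum, eval_eq_sum_range, finsetSum_coeff]
    refine Finset.sum_congr rfl fun k _ => ?_
    rw [eval_monomial, ← C_pow, coeff_mul_C]
  · rw [finsetSum_coeff]
    simp only [coeff_monomial]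
    rw [Finset.sum_ite_eq']
    split_ifs with h
    · rfl
    · rw [coeff_eq_zero_of_natDegree_lt (p := S), coeff_zero]
      simpa using h

/-- A product of operators of first order is a convergent Fuchsian operator. -/
theorem exists_fuchsianOperator_linearProd (l : List (ℂ × ℂ[X])) :
    ∃ M : FuchsianOperator, M.taylor = FormalOperator.linearProd l ∧
      ∀ (u : ℂ → ℂ) (t : ℂ), AnalyticAt ℂ u t → M.apply u t = firstOrderProd l u t := by
  obtain ⟨S, hS, hSu⟩ := exists_polynomial_linearProd l
  choose Q hQe hQc using exists_eval_eq_coeff_eval S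
  obtain ⟨hdeg, hlead⟩ :=
    FormalOperator.isFuchsian_iff.mp (FormalOperator.linearProd_isFuchsian l)
  refine ⟨⟨l.length, fun i t => (Q i).eval t,
    fun i => AnalyticOnNhd.eval_polynomial _ _ (Set.mem_univ _), ?_⟩, ?_, ?_⟩
  · rw [← coeff_zero_eq_eval_zero, hQc, hS, Fin.val_last]
    exact coeff_ne_zero_of_eq_degree hlead
  · funext k
    simp only [FuchsianOperator.taylor, iteratedDeriv_polynomial_eval_zero, hQc, hS]
    rw [Fin.sum_univ_eq_sum_range
      (fun i => C ((FormalOperator.linearProd l k).coeff i) * X ^ i) (l.length + 1)]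
    exact (as_sum_range_C_mul_X_pow' _ (Nat.lt_succ_of_le (hdeg k))).symm
  · intro u t hu
    have hlt : (S.eval (C t)).natDegree < l.length + 1 := by
      rw [Nat.lt_succ_iff, eval_eq_sum_range]
      refine natDegree_sum_le_of_forall_le _ _ fun k _ => ?_
      rw [← C_pow, hS]
      exact (natDegree_mul_C_le _ _).trans (hdeg k)
    rw [← hSu u t hu, polyAct_apply, sum_over_range' _ _ _ hlt]
    · simp only [FuchsianOperator.apply, hQe]
      exact Fin.sum_univ_eq_sum_range
        (fun i => (S.eval (C t)).coeff i * eulerDeriv^[i] u t) (l.length + 1)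
    · exact fun _ => zero_mul _

/-! ### Liouville integrability of first order equations. -/

theorem exists_derivative_eq (q : ℂ[X]) : ∃ S : ℂ[X], derivative S = q := by
  induction q using Polynomial.induction_on' with
  | add p q hp hq =>
    obtain ⟨S, rfl⟩ := hp
    obtain ⟨T, rfl⟩ := hq
    exact ⟨S + T, derivative_add⟩
  | monomial n a =>
    refine ⟨monomial (n + 1) (a / (n + 1 : ℕ)), ?_⟩
    rw [derivative_monomial, div_mul_cancel₀ _ (Nat.cast_ne_zero.mpr n.succ_ne_zero),
      Nat.add_sub_cancel]

namespace IsLiouvillianAt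

theorem polynomial (t₀ : ℂ) (p : ℂ[X]) : IsLiouvillianAt t₀ fun t => p.eval t := by
  simpa using rational (t₀ := t₀) p 1 (by simp)

theorem const (t₀ c : ℂ) : IsLiouvillianAt t₀ fun _ => c := by
  simpa using polynomial t₀ (C c)

theorem inv {t₀ : ℂ} (h : t₀ ≠ 0) : IsLiouvillianAt t₀ fun t => t⁻¹ := by
  simpa using rational (t₀ := t₀) 1 X (by simpa using h)

/-- Solutions of linear nonhomogeneous equations of first order are Liouvillian. -/
theorem of_firstOrder {t₀ : ℂ} (ht₀ : t₀ ≠ 0) {x : ℂ × ℂ[X]} (hx : x.2.eval 0 = 0) {f v : ℂ → ℂ}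
    (hf : IsLiouvillianAt t₀ f) (hv : AnalyticAt ℂ v t₀) (h : firstOrder x v =ᶠ[𝓝 t₀] f) :
    IsLiouvillianAt t₀ v := by
  obtain ⟨μ, r⟩ := x
  obtain ⟨q, hq⟩ : X ∣ r := by
    rw [X_dvd_iff, coeff_zero_eq_eval_zero]; exact hx
  -- `S` is a primitive of `r/t`, a polynomial because `r(0) = 0`; the integrating factor is `t^{-μ}
  -- e^S`, up to a constant.
  obtain ⟨S, hS⟩ := exists_derivative_eq q
  have hne : ∀ᶠ t in 𝓝 t₀, t ≠ 0 := isOpen_ne.mem_nhds ht₀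
  -- Dividing by `t₀` moves the base point to `1`, away from the cut of the principal logarithm.
  have hslit : ∀ᶠ t in 𝓝 t₀, t / t₀ ∈ Complex.slitPlane := by
    refine (continuousAt_id.div_const t₀).eventually (Complex.isOpen_slitPlane.mem_nhds ?_)
    simp [ht₀]
  have hlog : ∀ᶠ t in 𝓝 t₀, HasDerivAt (fun s => Complex.log (s / t₀)) t⁻¹ t := by
    filter_upwards [hslit, hne] with t ht htne
    refine (((hasDerivAt_id t).div_const t₀).clog ht).congr_deriv ?_
    simp only [id]
    field_simp
  have hlogL : IsLiouvillianAt t₀ fun t => Complex.log (t / t₀) := primitive (inv ht₀) hlog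
  -- `c = -1` gives the integrating factor and `c = 1` its inverse, so no division of Liouvillian
  -- germs is needed.
  have hexp : ∀ c : ℂ, IsLiouvillianAt t₀
      fun t => Complex.exp (c * (μ * Complex.log (t / t₀) + -1 * S.eval t)) := fun c =>
    exp (mul (const t₀ c)
      (add (mul (const t₀ μ) hlogL) (mul (const t₀ (-1)) (polynomial t₀ S))))
  have hw : IsLiouvillianAt t₀ fun t =>
      v t * Complex.exp (-1 * (μ * Complex.log (t / t₀) + -1 * S.eval t)) := by
    refine primitive (mul (mul hf (inv ht₀)) (hexp (-1))) ?_
    filter_upwards [hne, hlog, h, hv.eventually_analyticAt] with t htne htlog hft hvt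
    refine (hvt.differentiableAt.hasDerivAt.mul ((((htlog.const_mul μ).add
      ((S.hasDerivAt t).const_mul (-1))).const_mul (-1)).cexp)).congr_deriv ?_
    rw [← hft, hS]
    simp only [firstOrder, eulerDeriv, hq, eval_mul, eval_X, Pi.add_apply]
    field_simp
    ring
  refine congr (mul hw (hexp 1)) (Eventually.of_forall fun t => ?_)
  simp only [mul_assoc, ← Complex.exp_add]
  simp

theorem of_firstOrderProd {t₀ : ℂ} (ht₀ : t₀ ≠ 0) {l : List (ℂ × ℂ[X])}
    (hl : ∀ x ∈ l, x.2.eval 0 = 0) {f v : ℂ → ℂ} (hf : IsLiouvillianAt t₀ f)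
    (hv : AnalyticAt ℂ v t₀) (h : firstOrderProd l v =ᶠ[𝓝 t₀] f) : IsLiouvillianAt t₀ v := by
  induction l generalizing f with
  | nil => exact congr hf h.symm
  | cons x l ih =>
    refine ih (fun y hy => hl y (List.mem_cons_of_mem _ hy)) ?_ (EventuallyEq.refl _ _)
    exact of_firstOrder ht₀ (hl x List.mem_cons_self) hf (analyticAt_firstOrderProd hv) h

end IsLiouvillianAt

/-! ### From convergent operators to the corollary. -/

theorem FuchsianOperator.taylor_isFuchsian (L : FuchsianOperator) :
    L.taylor.IsFuchsian L.order := by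
  rw [FormalOperator.isFuchsian_iff]
  have hdeg : L.taylor.HasDegreeLE L.order := fun k =>
    natDegree_sum_le_of_forall_le _ _ fun i _ =>
      (natDegree_C_mul_X_pow_le _ _).trans (Nat.lt_succ_iff.mp i.2)
  refine ⟨hdeg, degree_eq_of_le_of_coeff_ne_zero (natDegree_le_iff_degree_le.mp (hdeg 0)) ?_⟩
  have : (L.taylor 0).coeff L.order = L.coeff (Fin.last _) 0 := by
    simp only [FuchsianOperator.taylor, finsetSum_coeff, coeff_C_mul, coeff_X_pow]
    rw [Finset.sum_eq_single (Fin.last _)]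
    · simp
    · intro i _ hi
      rw [if_neg, mul_zero]
      intro h
      exact hi (Fin.ext h.symm)
    · simp
  rw [this]
  exact L.leading_ne_zero

end Fuchs

end

theorem corollary1 (L : Fuchs.FuchsianOperator) :
    ∃ M : Fuchs.FuchsianOperator,
      Fuchs.FormalOperator.FEquivalent L.taylor M.taylor ∧
      M.IsLiouvilleIntegrable ∧
      ∃ (lam : Fin L.order → ℂ) (r : Fin L.order → Polynomial ℂ),
        (Finset.univ : Finset (Fin L.order)).val.map lam = L.taylor.eulerPart.roots ∧
        (∀ i, (r i).eval 0 = 0) ∧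
        (∀ i, ∃ μ ∈ L.taylor.eulerPart.roots, ∃ ν ∈ L.taylor.eulerPart.roots, ∃ j : ℕ,
          μ - ν = (j : ℂ) ∧ (r i).natDegree ≤ j) ∧
        M.taylor = Fuchs.FormalOperator.prod
          (List.ofFn fun i => Fuchs.FormalOperator.linearFactor (lam i) (r i)) := by
  have hL := L.taylor_isFuchsian
  obtain ⟨l, hl, hlr, H, K, hH, hK, hHK, hcop⟩ :=
    Fuchs.FormalOperator.exists_intertwining_linearProd _ _ hL
  obtain ⟨M, hM, hMapply⟩ := Fuchs.exists_fuchsianOperator_linearProd l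
  have hlen : l.length = L.order := by
    have h1 := congrArg Multiset.card hl
    rw [Multiset.coe_card, List.length_map,
      ← (IsAlgClosed.splits (L.taylor 0)).natDegree_eq_card_roots] at h1
    rw [h1]
    exact natDegree_eq_of_degree_eq_some hL.2
  -- The radius `1` is arbitrary: the argument works at every `t₀ ≠ 0`.
  refine ⟨M, ?_, ⟨1, one_pos, fun t₀ ht₀ _ u hu => ?_⟩, ?_⟩
  · rw [hM]
    exact Fuchs.FormalOperator.fEquivalent_of_intertwining hL
      (hlen ▸ Fuchs.FormalOperator.linearProd_isFuchsian l) hH hK hHK hcop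
  · refine Fuchs.IsLiouvillianAt.of_firstOrderProd ht₀ (fun x hx => (hlr x hx).1)
      (Fuchs.IsLiouvillianAt.const t₀ 0) hu.1 ?_
    filter_upwards [hu.2, hu.1.eventually_analyticAt] with t ht hut
    rw [← hMapply u t hut, ht]
  · rw [hM]
    generalize L.order = n at hlen
    subst hlen
    refine ⟨fun i => (l.get i).1, fun i => (l.get i).2, ?_,
      fun i => (hlr _ (l.get_mem i)).1, fun i => (hlr _ (l.get_mem i)).2, ?_⟩
    · rw [Fuchs.FormalOperator.eulerPart, ← hl, Fin.univ_val_map]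
      congr 1
      rw [← List.ofFn_get (l.map Prod.fst)]
      simp [List.ofFn_eq_map]
    · rw [Fuchs.FormalOperator.linearProd]
      congr 1
      conv_lhs => rw [← List.ofFn_get l]
      rw [List.map_ofFn]
      rfl
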